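/- Let $p=(p_1,\dots,p_n)$ be a system of $n$ complex polynomials in $n$ variables (for example an unmixed sparse system, i.e. one whose members all have the same support), and let $\xi\in(\mathbb C^\times)^n$ be a point at which the Jacobian $D_\xi(p)$ is invertible (for example a simple root of $p$ with no zero coordinate). Let $\|\cdot\|$ be any unitarily invariant norm on $\mathbb C^{n\times n}$, and define the local condition number by $\mu(f,\zeta)=\|f\|_W\,\|D_\zeta(f)^\dagger\|$, where $\dagger$ is the Moore–Penrose inverse and $\|f\|_W^2=\sum_i\sum_\alpha \frac{\alpha_1!\cdots\alpha_n!}{|\alpha|!}\,|f_{i,\alpha}|^2$ is the squared Bombieri–Weyl norm of $f_i=\sum_\alpha f_{i,\alpha}x^\alpha$. For $t\in\mathbb R_{>0}^n$ put $(t\cdot p)(x)=p(t_1^{-1}x_1,\dots,t_n^{-1}x_n)$, $t\cdot\xi=(t_1\xi_1,\dots,t_n\xi_n)$ and $t^{-1}=(t_1^{-1},\dots,t_n^{-1})$; for an $n\times n$ matrix $X$ put $(X\circ f)_i=\sum_j X_{ij}f_j$. Let $$h_\xi(t)=\log\sum_{i=1}^n|\xi|^{\omega_i}t^{-\omega_i},\qquad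 \omega_i=n e_i-(1,\dots,1),\qquad |\xi|^{\omega_i}=\prod_j|\xi_j|^{\omega_{ij}},\quad t^{-\omega_i}=\prod_j t_j^{-\omega_{ij}} .$$ Let $\mathrm{PD}(n)$ be the set of Hermitian positive definite complex $n\times n$ matrices. Identify $\mathrm{PD}(n)\times\mathbb R_{>0}^n$ with the space $K\backslash G$ of right cosets of $K=\mathrm U(n)\times(S^1)^n$ in $G=\mathrm{GL}_n(\mathbb C)\times(\mathbb C^\times)^n$ via $K(g,\tau)\mapsto\big((g^*g)^{1/2},|\tau|\big)$. A function $F$ on it is called geodesically convex if $s\mapsto F\big(K(e^{sH}g,e^{sv}\tau)\big)$ is convex on $\mathbb R$ for all $(g,\tau)\in G$, all Hermitian $H$ and all $v\in\mathbb R^n$. Then the functions $$(X,t)\mapsto \mu\big(X\circ(t^{-1}\cdot p),\,t^{-1}\cdot\xi\big)+h_\xi(t),\qquad (X,t)\mapsto \mu\big(X\circ(t\cdot p),\,t\cdot\xi\big)+h_\xi(t),\qquad (X,t)\mapsto h_\xi(t)$$ on $\mathrm{PD}(n)\times\mathbb R_{>0}^n$ are geodesically convex. Moreover, $t\in\mathbb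 R_{>0}^n$ minimizes $h_\xi$ over $\mathbb R_{>0}^n$ if and only if $|\xi_i|\,t_i^{-1}=|\xi_j|\,t_j^{-1}$ for all $i,j$. -/

import Mathlib

open scoped Matrix MatrixOrder ComplexOrder Nat ComplexConjugate

noncomputable section

namespace Precond

/-! Polynomial systems, the Bombieri-Weyl norm and the two group actions. -/

/-- The Bombieri-Weyl inner product on complex polynomials: distinct monomials are orthogonal and
`⟨x^α, x^α⟩ = α₁! ⋯ αₙ! / |α|!`. -/
def bwInner {σ : Type*} (f g : MvPolynomial σ ℂ) : ℂ :=
  ∑ α ∈ f.support,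
    (((α.prod fun _ k => (k ! : ℝ)) / (α.degree ! : ℝ) : ℝ) : ℂ) * (f.coeff α * conj (g.coeff α))

/-- The Bombieri-Weyl norm of a system of polynomials. -/
def bwNorm {σ ι : Type*} [Fintype ι] (f : ι → MvPolynomial σ ℂ) : ℝ :=
  Real.sqrt (∑ i, (bwInner (f i) (f i)).re)

/-- The shuffling action `X ∘ f = (∑ⱼ X₁ⱼ fⱼ, …, ∑ⱼ Xₘⱼ fⱼ)`. -/
def shuffle {σ ι : Type*} [Fintype ι] (X : Matrix ι ι ℂ) (f : ι → MvPolynomial σ ℂ) :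
    ι → MvPolynomial σ ℂ :=
  fun i => ∑ j, X i j • f j

/-- The scaling action of `t` on a polynomial, `(t · p)(x) = p(t₁⁻¹ x₁, …, tₙ⁻¹ xₙ)`. -/
def scalePoly {σ : Type*} (t : σ → ℝ) (p : MvPolynomial σ ℂ) : MvPolynomial σ ℂ :=
  MvPolynomial.bind₁ (fun j => MvPolynomial.C (((t j)⁻¹ : ℝ) : ℂ) * MvPolynomial.X j) p

/-- The scaling action of `t` on a system of polynomials. -/
def scaleSystem {σ ι : Type*} (t : σ → ℝ) (f : ι → MvPolynomial σ ℂ) : ι → MvPolynomial σ ℂ :=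
  fun i => scalePoly t (f i)

/-- The scaling action of `t` on a point, `t · ξ = (t₁ ξ₁, …, tₙ ξₙ)`. -/
def scalePoint {σ : Type*} (t : σ → ℝ) (ξ : σ → ℂ) : σ → ℂ := fun j => (t j : ℂ) * ξ j

/-- The Jacobian matrix of the system `f` at `ξ`. -/
def jacobian {σ ι : Type*} (f : ι → MvPolynomial σ ℂ) (ξ : σ → ℂ) : Matrix ι σ ℂ :=
  Matrix.of fun i j => MvPolynomial.eval ξ (MvPolynomial.pderiv j (f i))

/-! The Moore-Penrose inverse and the local condition number. -/

/-- `B` is a Moore-Penrose inverse of `A`. -/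
structure IsMoorePenrose {m n : Type*} [Fintype m] [Fintype n]
    (A : Matrix m n ℂ) (B : Matrix n m ℂ) : Prop where
  mul_mul_left : A * B * A = A
  mul_mul_right : B * A * B = B
  isHermitian_left : (A * B).IsHermitian
  isHermitian_right : (B * A).IsHermitian

theorem exists_isMoorePenrose {m n : Type*} [Fintype m] [Fintype n]
    (A : Matrix m n ℂ) : ∃ B, IsMoorePenrose A B := by
  classical
  set M := Aᴴ * A with hM
  have hMh : Mᴴ = M := Matrix.isHermitian_conjTranspose_mul_self A
  have hsa : IsSelfAdjoint M := hMh
  have hid : cfc (fun x : ℝ => x) M = M := cfc_id' ℝ M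
  have hc : ∀ f : ℝ → ℝ, ContinuousOn f (spectrum ℝ M) := fun f =>
    (Matrix.finite_real_spectrum (A := M)).continuousOn f
  have hmul : ∀ f g : ℝ → ℝ, cfc f M * cfc g M = cfc (fun x => f x * g x) M := fun f g =>
    (cfc_mul f g M (hc _) (hc _)).symm
  obtain ⟨P, hPh, hPM, hMP, hMPM, hPMP⟩ : ∃ P : Matrix n n ℂ, Pᴴ = P ∧ (P * M)ᴴ = P * M ∧
      (M * P)ᴴ = M * P ∧ M * P * M = M ∧ P * M * P = P := by
    have hs : ∀ f : ℝ → ℝ, (cfc f M)ᴴ = cfc f M := fun f =>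
      (cfc_predicate f M : IsSelfAdjoint (cfc f M))
    have h1 : cfc (fun x : ℝ => x⁻¹) M * M = cfc (fun x : ℝ => x⁻¹ * x) M := by
      have := hmul (fun x => x⁻¹) (fun x => x)
      rwa [hid] at this
    have h2 : M * cfc (fun x : ℝ => x⁻¹) M = cfc (fun x : ℝ => x * x⁻¹) M := by
      have := hmul (fun x => x) (fun x => x⁻¹)
      rwa [hid] at this
    refine ⟨cfc (fun x : ℝ => x⁻¹) M, hs _, ?_, ?_, ?_, ?_⟩
    · rw [h1, hs]
    · rw [h2, hs]
    · have := hmul (fun x => x * x⁻¹) (fun x => x)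
      rw [hid] at this
      rw [h2, this]
      simpa only [mul_inv_mul_cancel] using hid
    · rw [h1, hmul]
      congr 1
      ext x
      simpa using mul_inv_mul_cancel x⁻¹
  have hAPM : A * P * M = A := by
    have h : (A * P * M - A)ᴴ * (A * P * M - A) = 0 := by
      have e : (A * P * M - A)ᴴ = M * P * Aᴴ - Aᴴ := by
        simp only [Matrix.conjTranspose_sub, Matrix.conjTranspose_mul, hPh, hMh, Matrix.mul_assoc]
      have e1 : Aᴴ * (A * P * M - A) = 0 := by
        rw [Matrix.mul_sub, Matrix.mul_assoc A, ← Matrix.mul_assoc Aᴴ, ← hM, ← Matrix.mul_assoc,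
          hMPM, sub_self]
      rw [e, Matrix.sub_mul, Matrix.mul_assoc, e1, Matrix.mul_zero, sub_zero]
    exact sub_eq_zero.mp (Matrix.conjTranspose_mul_self_eq_zero.mp h)
  refine ⟨P * Aᴴ, ?_, ?_, ?_, ?_⟩
  · rw [← Matrix.mul_assoc, Matrix.mul_assoc, ← hM, hAPM]
  · rw [Matrix.mul_assoc P, ← hM, ← Matrix.mul_assoc, hPMP]
  · simp only [Matrix.IsHermitian, Matrix.conjTranspose_mul, Matrix.conjTranspose_conjTranspose,
      hPh, Matrix.mul_assoc]
  · rw [Matrix.mul_assoc, ← hM]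
    exact hPM

/-- The Moore-Penrose inverse is unique. -/
theorem IsMoorePenrose.unique {m n : Type*} [Fintype m] [Fintype n]
    {A : Matrix m n ℂ} {B C : Matrix n m ℂ} (hB : IsMoorePenrose A B) (hC : IsMoorePenrose A C) :
    B = C := by
  have h1 : A * B = A * C := by
    have e1 : (A * C) * (A * B) = A * B := by
      rw [← Matrix.mul_assoc, hC.mul_mul_left]
    have e2 : (A * B) * (A * C) = A * C := by
      rw [← Matrix.mul_assoc, hB.mul_mul_left]
    calc A * B = (A * B)ᴴ := hB.isHermitian_left.symm
      _ = ((A * C) * (A * B))ᴴ := by rw [e1]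
      _ = (A * B) * (A * C) := by
        rw [Matrix.conjTranspose_mul, hB.isHermitian_left, hC.isHermitian_left]
      _ = A * C := e2
  have h2 : B * A = C * A := by
    have e1 : (B * A) * (C * A) = B * A := by
      rw [Matrix.mul_assoc, ← Matrix.mul_assoc A, hC.mul_mul_left]
    have e2 : (C * A) * (B * A) = C * A := by
      rw [Matrix.mul_assoc, ← Matrix.mul_assoc A, hB.mul_mul_left]
    calc B * A = (B * A)ᴴ := hB.isHermitian_right.symm
      _ = ((B * A) * (C * A))ᴴ := by rw [e1]
      _ = (C * A) * (B * A) := by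
        rw [Matrix.conjTranspose_mul, hB.isHermitian_right, hC.isHermitian_right]
      _ = C * A := e2
  calc B = B * A * B := hB.mul_mul_right.symm
    _ = C * A * B := by rw [h2]
    _ = C * (A * B) := Matrix.mul_assoc _ _ _
    _ = C * (A * C) := by rw [h1]
    _ = C * A * C := (Matrix.mul_assoc _ _ _).symm
    _ = C := hC.mul_mul_right

/-- The Moore-Penrose inverse `A†`. -/
def pinv {m n : Type*} [Fintype m] [Fintype n] (A : Matrix m n ℂ) : Matrix n m ℂ :=
  Classical.choose (exists_isMoorePenrose A)

/-- `N` is a norm on complex matrices that is invariant under unitary matrices on both sides. -/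
structure IsUnitarilyInvariantNorm {m n : Type*} [Fintype m] [Fintype n] [DecidableEq m]
    [DecidableEq n] (N : Seminorm ℂ (Matrix m n ℂ)) : Prop where
  eq_zero : ∀ A, N A = 0 → A = 0
  unitary_mul_mul : ∀ U ∈ Matrix.unitaryGroup m ℂ, ∀ V ∈ Matrix.unitaryGroup n ℂ, ∀ A,
    N (U * A * V) = N A

/-- The local condition number `μ(f, ξ) = ‖f‖_W ‖D_ξ(f)†‖` with respect to the norm `N`. -/
def localCond {σ ι : Type*} [Fintype σ] [Fintype ι] (N : Seminorm ℂ (Matrix σ ι ℂ))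
    (f : ι → MvPolynomial σ ℂ) (ξ : σ → ℂ) : ℝ :=
  bwNorm f * N (pinv (jacobian f ξ))

/-! The function `h_ξ`. -/

/-- The exponent vectors `ω_i = n e_i - (1, …, 1)`. -/
def omega (n : ℕ) (i j : Fin n) : ℤ := (n : ℤ) * (Pi.single i 1 : Fin n → ℤ) j - 1

/-- `h_ξ(t) = log (∑ᵢ |ξ|^{ω_i} t^{-ω_i})`. -/
def hFun {n : ℕ} (ξ : Fin n → ℂ) (t : Fin n → ℝ) : ℝ :=
  Real.log (∑ i, (∏ j, ‖ξ j‖ ^ omega n i j) * (∏ j, t j ^ (-omega n i j)))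

/-! The manifold `PD(n) × ℝ_{>0}^n` as the space of right cosets `K \ G` of
`K = U(n) × (S¹)^n` in `G = GL_n(ℂ) × (ℂˣ)^n`, and its geodesics. -/

/-- Hermitian positive definite complex matrices. -/
abbrev PD (n : ℕ) : Type := {X : Matrix (Fin n) (Fin n) ℂ // X.PosDef}

/-- Vectors with positive real entries. -/
abbrev PosVec (n : ℕ) : Type := {t : Fin n → ℝ // ∀ i, 0 < t i}

/-- The group `GL_n(ℂ) × (ℂˣ)^n`. -/
abbrev PreGroup (n : ℕ) : Type := GL (Fin n) ℂ × (Fin n → ℂˣ)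

/-- The maximal compact subgroup `U(n) × (S¹)^n`, as a set. -/
def maxCompact (n : ℕ) : Set (PreGroup n) :=
  {k | (k.1 : Matrix (Fin n) (Fin n) ℂ) ∈ Matrix.unitaryGroup (Fin n) ℂ ∧ ∀ i, ‖(k.2 i : ℂ)‖ = 1}

theorem posDef_gram {n : ℕ} (g : GL (Fin n) ℂ) :
    ((g : Matrix (Fin n) (Fin n) ℂ)ᴴ * (g : Matrix (Fin n) (Fin n) ℂ)).PosDef :=
  (Matrix.posSemidef_conjTranspose_mul_self _).posDef_iff_isUnit.mpr
    ((g.isUnit.star).mul g.isUnit)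

theorem posDef_sqrt_gram {n : ℕ} (g : GL (Fin n) ℂ) :
    (CFC.sqrt ((g : Matrix (Fin n) (Fin n) ℂ)ᴴ * (g : Matrix (Fin n) (Fin n) ℂ))).PosDef :=
  Matrix.isStrictlyPositive_iff_posDef.mp (posDef_gram g).isStrictlyPositive.sqrt

/-- The representative of the coset `K (g, τ)` in `PD(n) × ℝ_{>0}^n`, namely
`((g* g)^{1/2}, |τ|)`, the positive part of the polar decomposition. -/
def cosetRep {n : ℕ} (g : PreGroup n) : PD n × PosVec n :=
  (⟨CFC.sqrt ((g.1 : Matrix (Fin n) (Fin n) ℂ)ᴴ * (g.1 : Matrix (Fin n) (Fin n) ℂ)),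
      posDef_sqrt_gram g.1⟩,
    ⟨fun i => ‖(g.2 i : ℂ)‖, fun i => norm_pos_iff.mpr (g.2 i).ne_zero⟩)

/-- The fibres of `cosetRep` are exactly the right cosets `K g`. -/
theorem cosetRep_eq_iff {n : ℕ} (g g' : PreGroup n) :
    cosetRep g = cosetRep g' ↔ ∃ k ∈ maxCompact n, g' = k * g := by
  constructor
  · intro h
    have h1 := congrArg (fun q => q.1.1) h
    have h2 : ∀ i, ‖(g.2 i : ℂ)‖ = ‖(g'.2 i : ℂ)‖ := fun i => congrArg (fun q => q.2.1 i) h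
    simp only [cosetRep] at h1
    have h3 : (g.1 : Matrix (Fin n) (Fin n) ℂ)ᴴ * g.1 = (g'.1 : Matrix (Fin n) (Fin n) ℂ)ᴴ * g'.1 := by
      rw [← CFC.sqrt_mul_sqrt_self _ (posDef_gram g.1).posSemidef.nonneg, h1,
        CFC.sqrt_mul_sqrt_self _ (posDef_gram g'.1).posSemidef.nonneg]
    refine ⟨g' * g⁻¹, ⟨?_, fun i => ?_⟩, by simp⟩
    · rw [Matrix.mem_unitaryGroup_iff']
      have e : (g.1 : Matrix (Fin n) (Fin n) ℂ) * ((g.1⁻¹ : GL (Fin n) ℂ) : Matrix _ _ ℂ) = 1 :=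
        Units.mul_inv g.1
      have e' : ((g.1⁻¹ : GL (Fin n) ℂ) : Matrix _ _ ℂ)ᴴ * (g.1 : Matrix (Fin n) (Fin n) ℂ)ᴴ = 1 := by
        rw [← Matrix.conjTranspose_mul, e, Matrix.conjTranspose_one]
      simp only [Prod.fst_mul, Prod.fst_inv, Units.val_mul, Matrix.star_eq_conjTranspose,
        Matrix.conjTranspose_mul]
      rw [Matrix.mul_assoc, ← Matrix.mul_assoc _ (g'.1 : Matrix (Fin n) (Fin n) ℂ), ← h3,
        Matrix.mul_assoc, e, Matrix.mul_one, e']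
    · simp [h2 i]
  · rintro ⟨k, ⟨hk1, hk2⟩, rfl⟩
    rw [Matrix.mem_unitaryGroup_iff', Matrix.star_eq_conjTranspose] at hk1
    refine Prod.ext (Subtype.ext ?_) (Subtype.ext (funext fun i => ?_))
    · simp only [cosetRep, Prod.fst_mul, Units.val_mul, Matrix.conjTranspose_mul]
      rw [Matrix.mul_assoc _ _ ((k.1 : Matrix (Fin n) (Fin n) ℂ) * _),
        ← Matrix.mul_assoc _ (k.1 : Matrix (Fin n) (Fin n) ℂ), hk1, Matrix.one_mul]
    · simp [cosetRep, hk2 i]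

/-- A point of `PD(n) × ℝ_{>0}^n`, as a group element, represents its own coset. -/
theorem cosetRep_self {n : ℕ} (q : PD n × PosVec n) (g : PreGroup n)
    (h1 : (g.1 : Matrix (Fin n) (Fin n) ℂ) = q.1.1) (h2 : ∀ i, (g.2 i : ℂ) = (q.2.1 i : ℂ)) :
    cosetRep g = q := by
  refine Prod.ext (Subtype.ext ?_) (Subtype.ext (funext fun i => ?_))
  · have h : (q.1.1)ᴴ = q.1.1 := q.1.2.isHermitian
    simp only [cosetRep, h1, h]
    exact CFC.sqrt_mul_self _ q.1.2.posSemidef.nonneg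
  · simp [cosetRep, h2 i, abs_of_pos (q.2.2 i)]

/-- The group element `(e^H, e^v)`. -/
def expPair {n : ℕ} (H : Matrix (Fin n) (Fin n) ℂ) (v : Fin n → ℝ) : PreGroup n :=
  ((Matrix.isUnit_exp H).unit, fun i => Units.mk0 (Real.exp (v i) : ℂ) (by
    exact_mod_cast (Real.exp_pos (v i)).ne'))

/-- `F` is geodesically convex on `PD(n) × ℝ_{>0}^n ≅ K \ G`: it is convex along every geodesic
`s ↦ K e^{sH} g`, where `g ∈ G` and `H ∈ i Lie(K) = Herm(n) × ℝ^n`. -/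
def GeodesicallyConvex {n : ℕ} (F : PD n × PosVec n → ℝ) : Prop :=
  ∀ (g : PreGroup n) (H : Matrix (Fin n) (Fin n) ℂ) (v : Fin n → ℝ), H.IsHermitian →
    ConvexOn ℝ Set.univ (fun s : ℝ => F (cosetRep (expPair (s • H) (s • v) * g)))

end Precond

end

/-!
Every geodesic of `K \ G` is a line in some flat `(x, y) ↦ K (e^{diag x} A, e^y)` with
`x, y ∈ ℝ^n`. The Bombieri-Weyl norm and `N` are unitarily invariant, so `μ` may be computed at
`(e^{diag x} A, e^y)` instead of at the positive representative of its coset. There `‖·‖_W ^ 2` is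
a sum of exponentials of linear forms in `(x, y)`, hence log-convex. The inverse Jacobian
`e^{diag y} J⁻¹ e^{-diag x}` extends holomorphically to complex `x` and `y`, whose imaginary parts
act by unitary matrices and do not affect its norm, so Hadamard's three lines theorem makes this
norm log-convex too. Thus `μ` is a product of log-convex functions, while `h_ξ` is a log-sum-exp of
linear forms in `log t`, whose minimizers are given by the equality case of the inequality between
the arithmetic and geometric means of the numbers `(|ξ_i| t_i⁻¹) ^ n`.
-/

noncomputable section

namespace Precond

/-- Logarithmic convexity of a real function on a real vector space. It is stated
multiplicatively so that the function may vanish (note `0 ^ 0 = 1` at the endpoints). -/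
structure LogConvex {E : Type*} [AddCommGroup E] [Module ℝ E] (f : E → ℝ) : Prop where
  nonneg : ∀ x, 0 ≤ f x
  le_rpow_mul_rpow : ∀ (x y : E) {a b : ℝ}, 0 ≤ a → 0 ≤ b → a + b = 1 →
    f (a • x + b • y) ≤ f x ^ a * f y ^ b

section LogConvex

variable {E E' ι : Type*} [AddCommGroup E] [Module ℝ E] [AddCommGroup E'] [Module ℝ E']

theorem logConvex_const {c : ℝ} (hc : 0 ≤ c) : LogConvex fun _ : E => c where
  nonneg _ := hc
  le_rpow_mul_rpow _ _ _ _ ha hb hab := by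
    rw [← Real.rpow_add_of_nonneg hc ha hb, hab, Real.rpow_one]

theorem logConvex_exp {u : E → ℝ} (hu : ConvexOn ℝ Set.univ u) :
    LogConvex fun x => Real.exp (u x) where
  nonneg _ := (Real.exp_pos _).le
  le_rpow_mul_rpow x y a b ha hb hab := by
    rw [← Real.exp_mul, ← Real.exp_mul, ← Real.exp_add, Real.exp_le_exp]
    simpa only [smul_eq_mul, mul_comm] using hu.2 trivial trivial ha hb hab

theorem logConvex_exp_zpow (ℓ : E →ₗ[ℝ] ℝ) (k : ℤ) : LogConvex fun x => Real.exp (ℓ x) ^ k := by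
  simpa only [LinearMap.smul_apply, smul_eq_mul, mul_comm (k : ℝ), Real.exp_mul,
    Real.rpow_intCast] using logConvex_exp (((k : ℝ) • ℓ).convexOn convex_univ)

namespace LogConvex

variable {f g : E → ℝ}

theorem mul (hf : LogConvex f) (hg : LogConvex g) : LogConvex fun x => f x * g x where
  nonneg x := mul_nonneg (hf.nonneg x) (hg.nonneg x)
  le_rpow_mul_rpow x y a b ha hb hab := by
    have hf_rpow : 0 ≤ f x ^ a * f y ^ b :=
      mul_nonneg (Real.rpow_nonneg (hf.nonneg _) _) (Real.rpow_nonneg (hf.nonneg _) _)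
    calc f (a • x + b • y) * g (a • x + b • y)
        ≤ (f x ^ a * f y ^ b) * (g x ^ a * g y ^ b) :=
          mul_le_mul (hf.le_rpow_mul_rpow x y ha hb hab) (hg.le_rpow_mul_rpow x y ha hb hab)
            (hg.nonneg _) hf_rpow
      _ = (f x * g x) ^ a * (f y * g y) ^ b := by
          rw [Real.mul_rpow (hf.nonneg _) (hg.nonneg _), Real.mul_rpow (hf.nonneg _) (hg.nonneg _),
            mul_mul_mul_comm]

theorem prod {S : Finset ι} {f : ι → E → ℝ} (hf : ∀ i ∈ S, LogConvex (f i)) :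
    LogConvex fun x => ∏ i ∈ S, f i x := by
  classical
  induction S using Finset.induction_on with
  | empty => simpa only [Finset.prod_empty] using logConvex_const zero_le_one
  | insert i S hi ih =>
    simp only [Finset.prod_insert hi]
    exact (hf i (Finset.mem_insert_self i S)).mul
      (ih fun j hj => hf j (Finset.mem_insert_of_mem hj))

theorem rpow (hf : LogConvex f) {r : ℝ} (hr : 0 ≤ r) : LogConvex fun x => f x ^ r where
  nonneg x := Real.rpow_nonneg (hf.nonneg x) r
  le_rpow_mul_rpow x y a b ha hb hab := by
    calc f (a • x + b • y) ^ r ≤ (f x ^ a * f y ^ b) ^ r :=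
          Real.rpow_le_rpow (hf.nonneg _) (hf.le_rpow_mul_rpow x y ha hb hab) hr
      _ = (f x ^ r) ^ a * (f y ^ r) ^ b := by
          rw [Real.mul_rpow (Real.rpow_nonneg (hf.nonneg _) _) (Real.rpow_nonneg (hf.nonneg _) _),
            ← Real.rpow_mul (hf.nonneg _), ← Real.rpow_mul (hf.nonneg _), mul_comm a, mul_comm b,
            Real.rpow_mul (hf.nonneg _), Real.rpow_mul (hf.nonneg _)]

theorem pow (hf : LogConvex f) (k : ℕ) : LogConvex fun x => f x ^ k := by
  simpa only [Real.rpow_natCast] using hf.rpow k.cast_nonneg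

theorem sqrt (hf : LogConvex f) : LogConvex fun x => √(f x) := by
  simpa only [Real.sqrt_eq_rpow] using hf.rpow one_half_pos.le

/-- This is Hölder's inequality with exponents `1 / a` and `1 / b`. -/
theorem sum {S : Finset ι} {f : ι → E → ℝ} (hf : ∀ i ∈ S, LogConvex (f i)) :
    LogConvex fun x => ∑ i ∈ S, f i x where
  nonneg x := Finset.sum_nonneg fun i hi => (hf i hi).nonneg x
  le_rpow_mul_rpow x y a b ha hb hab := by
    rcases ha.eq_or_lt with rfl | ha_pos
    · obtain rfl : b = 1 := by linarith
      simp
    rcases hb.eq_or_lt with rfl | hb_pos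
    · obtain rfl : a = 1 := by linarith
      simp
    have rpow_inv_rpow : ∀ {c : ℝ}, 0 < c → ∀ z, ∑ i ∈ S, (f i z ^ c) ^ (1 / c) = ∑ i ∈ S, f i z :=
      fun hc z => Finset.sum_congr rfl fun i hi => by
        rw [one_div, Real.rpow_rpow_inv ((hf i hi).nonneg z) hc.ne']
    calc ∑ i ∈ S, f i (a • x + b • y) ≤ ∑ i ∈ S, f i x ^ a * f i y ^ b :=
          Finset.sum_le_sum fun i hi => (hf i hi).le_rpow_mul_rpow x y ha hb hab
      _ ≤ (∑ i ∈ S, (f i x ^ a) ^ (1 / a)) ^ (1 / (1 / a)) *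
            (∑ i ∈ S, (f i y ^ b) ^ (1 / b)) ^ (1 / (1 / b)) :=
          Real.inner_le_Lp_mul_Lq_of_nonneg S (Real.holderConjugate_one_div ha_pos hb_pos hab)
            (fun i hi => Real.rpow_nonneg ((hf i hi).nonneg x) a)
            (fun i hi => Real.rpow_nonneg ((hf i hi).nonneg y) b)
      _ = (∑ i ∈ S, f i x) ^ a * (∑ i ∈ S, f i y) ^ b := by
          rw [one_div_one_div, one_div_one_div, rpow_inv_rpow ha_pos, rpow_inv_rpow hb_pos]

theorem comp_linearMap (hf : LogConvex f) (L : E' →ₗ[ℝ] E) : LogConvex fun x => f (L x) where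
  nonneg x := hf.nonneg (L x)
  le_rpow_mul_rpow x y _ _ ha hb hab := by
    simpa only [map_add, map_smul] using hf.le_rpow_mul_rpow (L x) (L y) ha hb hab

theorem convexOn (hf : LogConvex f) : ConvexOn ℝ Set.univ f :=
  ⟨convex_univ, fun x _ y _ _ _ ha hb hab => (hf.le_rpow_mul_rpow x y ha hb hab).trans
    (Real.geom_mean_le_arith_mean2_weighted ha hb (hf.nonneg _) (hf.nonneg _) hab)⟩

theorem convexOn_log (hf : LogConvex f) (hpos : ∀ x, 0 < f x) :
    ConvexOn ℝ Set.univ fun x => Real.log (f x) := by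
  refine ⟨convex_univ, fun x _ y _ a b ha hb hab => ?_⟩
  have log_le := Real.log_le_log (hpos _) (hf.le_rpow_mul_rpow x y ha hb hab)
  rwa [Real.log_mul (Real.rpow_pos_of_pos (hpos _) _).ne' (Real.rpow_pos_of_pos (hpos _) _).ne',
    Real.log_rpow (hpos _), Real.log_rpow (hpos _)] at log_le

end LogConvex

end LogConvex

section ThreeLines

theorem norm_le_rpow_mul_rpow_of_norm_eq_norm_re {V : Type*} [NormedAddCommGroup V]
    [NormedSpace ℂ V] {F : ℂ → V} (hF : Differentiable ℂ F) (hre : ∀ z, ‖F z‖ = ‖F z.re‖)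
    {a b : ℝ} (ha : 0 ≤ a) (hb : 0 ≤ b) (hab : a + b = 1) :
    ‖F b‖ ≤ ‖F 0‖ ^ a * ‖F 1‖ ^ b := by
  have bdd : BddAbove ((norm ∘ F) '' Complex.HadamardThreeLines.verticalClosedStrip 0 1) := by
    have hcont : Continuous fun r : ℝ => ‖F r‖ :=
      (hF.continuous.comp Complex.continuous_ofReal).norm
    refine ((isCompact_Icc (a := (0 : ℝ)) (b := 1)).image hcont).bddAbove.mono ?_
    rintro _ ⟨z, hz, rfl⟩
    exact ⟨z.re, hz, (hre z).symm⟩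
  have b_mem_strip : (b : ℂ) ∈ Complex.HadamardThreeLines.verticalClosedStrip 0 1 :=
    ⟨hb, by simpa only [Complex.ofReal_re] using (by linarith : b ≤ 1)⟩
  have three_lines :=
    Complex.HadamardThreeLines.norm_le_interp_of_mem_verticalClosedStrip₀₁' F b_mem_strip
      hF.diffContOnCl bdd (a := ‖F 0‖) (b := ‖F 1‖)
      (fun z (hz : z.re = 0) => by rw [hre, hz, Complex.ofReal_zero])
      (fun z (hz : z.re = 1) => by rw [hre, hz, Complex.ofReal_one])
  rwa [Complex.ofReal_re, ← eq_sub_of_add_eq hab] at three_lines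

theorem seminorm_le_rpow_mul_rpow_of_eq_re {V κ : Type*} [AddCommGroup V] [Module ℂ V]
    [Finite κ] (basis : Module.Basis κ ℂ V) {N : Seminorm ℂ V} (hN : ∀ v, N v = 0 → v = 0)
    {F : ℂ → V} (hF : ∀ k, Differentiable ℂ fun z => basis.repr (F z) k)
    (hre : ∀ z, N (F z) = N (F z.re)) {a b : ℝ} (ha : 0 ≤ a) (hb : 0 ≤ b) (hab : a + b = 1) :
    N (F b) ≤ N (F 0) ^ a * N (F 1) ^ b := by
  have := Fintype.ofFinite κ
  let : NormedAddCommGroup V := AddGroupNorm.toNormedAddCommGroup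
    { N.toAddGroupSeminorm with eq_zero_of_map_eq_zero' := hN }
  let : NormedSpace ℂ V := ⟨fun c v => (map_smul_eq_mul N c v).le⟩
  have hF' : Differentiable ℂ fun z => ∑ k, basis.repr (F z) k • basis k :=
    Differentiable.fun_sum fun k _ => (hF k).smul_const (basis k)
  simp only [Module.Basis.sum_repr] at hF'
  exact norm_le_rpow_mul_rpow_of_norm_eq_norm_re hF' hre ha hb hab

end ThreeLines

section UnitarilyInvariantNorm

open Matrix

variable {m n : Type*} [DecidableEq m] [DecidableEq n]

/-- The exponential of the diagonal matrix with entries `x`, i.e. the point `e ^ x` of the complex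
torus acting on row or column vectors. It is unitary for purely imaginary `x`. -/
def expDiag (x : m → ℂ) : Matrix m m ℂ := diagonal fun i => Complex.exp (x i)

theorem expDiag_zero : expDiag (0 : m → ℂ) = 1 := by
  simp only [expDiag, Pi.zero_apply, Complex.exp_zero, diagonal_one]

variable [Fintype m] [Fintype n]

theorem expDiag_add (x y : m → ℂ) : expDiag (x + y) = expDiag x * expDiag y := by
  simp only [expDiag, Pi.add_apply, Complex.exp_add, diagonal_mul_diagonal]

theorem expDiag_mul_neg (x : m → ℂ) : expDiag x * expDiag (-x) = 1 := by
  rw [← expDiag_add, add_neg_cancel, expDiag_zero]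

theorem expDiag_mem_unitaryGroup {x : m → ℂ} (hx : ∀ i, (x i).re = 0) :
    expDiag x ∈ unitaryGroup m ℂ := by
  have star_expDiag : star (expDiag x) = expDiag (-x) := by
    rw [star_eq_conjTranspose, expDiag, diagonal_conjTranspose, expDiag]
    congr 1
    ext i
    rw [Pi.star_apply, RCLike.star_def, ← Complex.exp_conj, Pi.neg_apply]
    congr 1
    apply Complex.ext <;> simp [hx i]
  rw [mem_unitaryGroup_iff, star_expDiag, expDiag_mul_neg]

theorem exp_diagonal_eq_expDiag (x : m → ℂ) : NormedSpace.exp (diagonal x) = expDiag x := by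
  rw [exp_diagonal, expDiag]
  congr 1
  ext i
  rw [Pi.coe_exp, Complex.exp_eq_exp_ℂ]

namespace IsUnitarilyInvariantNorm

variable {N : Seminorm ℂ (Matrix m n ℂ)}

theorem mul_unitary (hN : IsUnitarilyInvariantNorm N) (A : Matrix m n ℂ) {V : Matrix n n ℂ}
    (hV : V ∈ unitaryGroup n ℂ) : N (A * V) = N A := by
  simpa only [Matrix.one_mul] using hN.unitary_mul_mul 1 (one_mem _) V hV A

theorem expDiag_mul_mul_expDiag_congr (hN : IsUnitarilyInvariantNorm N) {x x' : m → ℂ}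
    {y y' : n → ℂ} (hx : ∀ i, (x i).re = (x' i).re) (hy : ∀ j, (y j).re = (y' j).re)
    (B : Matrix m n ℂ) :
    N (expDiag x * B * expDiag y) = N (expDiag x' * B * expDiag y') := by
  have split_phases : expDiag x * B * expDiag y =
      expDiag (x - x') * (expDiag x' * B * expDiag y') * expDiag (y - y') := by
    nth_rw 1 [← sub_add_cancel x x', ← add_sub_cancel y' y]
    simp only [expDiag_add, Matrix.mul_assoc]
  rw [split_phases, hN.unitary_mul_mul]
  · exact expDiag_mem_unitaryGroup fun i => by simp [hx]
  · exact expDiag_mem_unitaryGroup fun j => by simp [hy]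

theorem logConvex_expDiag_mul_mul_expDiag (hN : IsUnitarilyInvariantNorm N) (B : Matrix m n ℂ) :
    LogConvex fun x : (m → ℝ) × (n → ℝ) =>
      N (expDiag (fun i => (x.1 i : ℂ)) * B * expDiag fun j => (x.2 j : ℂ)) where
  nonneg _ := apply_nonneg N _
  le_rpow_mul_rpow x y a b ha hb hab := by
    obtain rfl : a = 1 - b := eq_sub_of_add_eq hab
    let rowExponent (z : ℂ) (i : m) : ℂ := (1 - z) * x.1 i + z * y.1 i
    let colExponent (z : ℂ) (j : n) : ℂ := (1 - z) * x.2 j + z * y.2 j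
    let F (z : ℂ) : Matrix m n ℂ := expDiag (rowExponent z) * B * expDiag (colExponent z)
    have F_differentiable (k : m × n) :
        Differentiable ℂ fun z => (Matrix.stdBasis ℂ m n).repr (F z) k := by
      change Differentiable ℂ fun z => F z k.1 k.2
      simp only [F, rowExponent, colExponent, expDiag, mul_diagonal, diagonal_mul]
      fun_prop
    have F_re (z : ℂ) : N (F z) = N (F z.re) :=
      hN.expDiag_mul_mul_expDiag_congr (fun i => by simp [rowExponent])
        (fun j => by simp [colExponent]) B
    convert seminorm_le_rpow_mul_rpow_of_eq_re (Matrix.stdBasis ℂ m n) hN.eq_zero F_differentiable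
      F_re ha hb hab using 4
    all_goals simp [F, rowExponent, colExponent]

end IsUnitarilyInvariantNorm

end UnitarilyInvariantNorm

section PolynomialSystem

open MvPolynomial

variable {σ ι : Type*}

theorem scalePoly_monomial (t : σ → ℝ) (α : σ →₀ ℕ) (c : ℂ) :
    scalePoly t (monomial α c) =
      monomial α (c * ((α.prod fun j k => (t j)⁻¹ ^ k : ℝ) : ℂ)) := by
  rw [scalePoly, bind₁_monomial, monomial_eq, map_mul, mul_assoc]
  simp only [mul_pow, Finset.prod_mul_distrib, Finsupp.prod, Complex.ofReal_prod,
    Complex.ofReal_pow, map_prod, map_pow]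

theorem coeff_scalePoly (t : σ → ℝ) (p : MvPolynomial σ ℂ) (α : σ →₀ ℕ) :
    (scalePoly t p).coeff α = p.coeff α * ((α.prod fun j k => (t j)⁻¹ ^ k : ℝ) : ℂ) := by
  classical
  induction p using MvPolynomial.induction_on' with
  | monomial β c =>
    rw [scalePoly_monomial, coeff_monomial, coeff_monomial, ite_mul, zero_mul]
    split_ifs with hβ
    · rw [hβ]
    · rfl
  | add p q hp hq =>
    have scalePoly_add : scalePoly t (p + q) = scalePoly t p + scalePoly t q := map_add _ _ _
    rw [scalePoly_add, coeff_add, hp, hq, coeff_add, add_mul]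

theorem support_scalePoly_subset (t : σ → ℝ) (p : MvPolynomial σ ℂ) :
    (scalePoly t p).support ⊆ p.support := fun α hα => by
  rw [mem_support_iff, coeff_scalePoly] at hα
  exact mem_support_iff.mpr (left_ne_zero_of_mul hα)

theorem pderiv_scalePoly (t : σ → ℝ) (p : MvPolynomial σ ℂ) (j : σ) :
    pderiv j (scalePoly t p) = C (((t j)⁻¹ : ℝ) : ℂ) * scalePoly t (pderiv j p) := by
  ext α
  have prod_add_single : ((α + Finsupp.single j 1).prod fun j k => (t j)⁻¹ ^ k) =
      (α.prod fun j k => (t j)⁻¹ ^ k) * (t j)⁻¹ := by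
    rw [Finsupp.prod_add_index' (fun _ => pow_zero _) (fun _ => pow_add _)]
    simp only [pow_zero, Finsupp.prod_single_index, pow_one]
  rw [coeff_C_mul, coeff_pderiv, coeff_scalePoly, coeff_scalePoly, coeff_pderiv, prod_add_single,
    Complex.ofReal_mul]
  ring

theorem eval_scalePoint_scalePoly {t : σ → ℝ} (ht : ∀ j, t j ≠ 0) (p : MvPolynomial σ ℂ)
    (ξ : σ → ℂ) : eval (scalePoint t ξ) (scalePoly t p) = eval ξ p := by
  rw [scalePoly, eval, eval₂Hom_bind₁]
  congr 2
  ext j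
  have htj : (t j : ℂ) ≠ 0 := Complex.ofReal_ne_zero.mpr (ht j)
  simp [scalePoint, htj]

theorem jacobian_scaleSystem [Fintype σ] [DecidableEq σ] {t : σ → ℝ} (ht : ∀ j, t j ≠ 0)
    (f : ι → MvPolynomial σ ℂ) (ξ : σ → ℂ) :
    jacobian (scaleSystem t f) (scalePoint t ξ) =
      jacobian f ξ * Matrix.diagonal fun j => (((t j)⁻¹ : ℝ) : ℂ) := by
  ext i j
  simp only [Matrix.mul_diagonal, jacobian, Matrix.of_apply, scaleSystem, pderiv_scalePoly, map_mul,
    eval_C, eval_scalePoint_scalePoly ht, mul_comm]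

section Shuffle

variable [Fintype ι]

theorem jacobian_shuffle (X : Matrix ι ι ℂ) (f : ι → MvPolynomial σ ℂ) (ξ : σ → ℂ) :
    jacobian (shuffle X f) ξ = X * jacobian f ξ := by
  ext i j
  simp only [jacobian, shuffle, Matrix.of_apply, map_sum, Derivation.map_smul, smul_eval,
    Matrix.mul_apply]

theorem shuffle_mul (X Y : Matrix ι ι ℂ) (f : ι → MvPolynomial σ ℂ) :
    shuffle (X * Y) f = shuffle X (shuffle Y f) := by
  funext i
  simp only [shuffle, Matrix.mul_apply, Finset.sum_smul, Finset.smul_sum, smul_smul]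
  exact Finset.sum_comm

theorem scaleSystem_shuffle (t : σ → ℝ) (X : Matrix ι ι ℂ) (f : ι → MvPolynomial σ ℂ) :
    scaleSystem t (shuffle X f) = shuffle X (scaleSystem t f) := by
  funext i
  simp only [scaleSystem, shuffle, scalePoly, map_sum, map_smul]

theorem coeff_shuffle (X : Matrix ι ι ℂ) (f : ι → MvPolynomial σ ℂ) (i : ι) (α : σ →₀ ℕ) :
    (shuffle X f i).coeff α = (X *ᵥ fun j => (f j).coeff α) i := by
  simp only [shuffle, coeff_sum, coeff_smul, smul_eq_mul, Matrix.mulVec, dotProduct]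

theorem support_shuffle_subset (X : Matrix ι ι ℂ) {f : ι → MvPolynomial σ ℂ}
    {S : Finset (σ →₀ ℕ)} (hS : ∀ j, (f j).support ⊆ S) (i : ι) : (shuffle X f i).support ⊆ S := by
  classical
  exact support_sum.trans (Finset.biUnion_subset.mpr fun j _ => support_smul.trans (hS j))

end Shuffle

/-- The weight `α₁! ⋯ αₙ! / |α|!` of the monomial `x^α` in the Bombieri-Weyl norm. -/
def bwWeight (α : σ →₀ ℕ) : ℝ := (α.prod fun _ k => (k ! : ℝ)) / (α.degree ! : ℝ)

theorem bwWeight_nonneg (α : σ →₀ ℕ) : 0 ≤ bwWeight α :=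
  div_nonneg (Finset.prod_nonneg fun _ _ => Nat.cast_nonneg _) (Nat.cast_nonneg _)

theorem re_bwInner_self {f : MvPolynomial σ ℂ} {S : Finset (σ →₀ ℕ)} (hS : f.support ⊆ S) :
    (bwInner f f).re = ∑ α ∈ S, bwWeight α * ‖f.coeff α‖ ^ 2 := by
  rw [bwInner, Complex.re_sum]
  calc ∑ α ∈ f.support, ((bwWeight α : ℂ) * (f.coeff α * conj (f.coeff α))).re
      = ∑ α ∈ f.support, bwWeight α * ‖f.coeff α‖ ^ 2 :=
        Finset.sum_congr rfl fun α _ => by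
          rw [Complex.re_ofReal_mul, Complex.mul_conj', ← Complex.ofReal_pow, Complex.ofReal_re]
    _ = ∑ α ∈ S, bwWeight α * ‖f.coeff α‖ ^ 2 :=
        Finset.sum_subset hS fun α _ hα => by
          rw [notMem_support_iff.mp hα, norm_zero, zero_pow two_ne_zero, mul_zero]

theorem exists_finset_support_subset [Finite ι] (f : ι → MvPolynomial σ ℂ) :
    ∃ S : Finset (σ →₀ ℕ), ∀ i, (f i).support ⊆ S := by
  classical
  have := Fintype.ofFinite ι
  exact ⟨Finset.univ.biUnion fun i => (f i).support,
    fun i => Finset.subset_biUnion_of_mem (fun i => (f i).support) (Finset.mem_univ i)⟩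

variable [Fintype ι]

theorem bwNorm_eq_sqrt_sum {f : ι → MvPolynomial σ ℂ} {S : Finset (σ →₀ ℕ)}
    (hS : ∀ i, (f i).support ⊆ S) :
    bwNorm f = √(∑ α ∈ S, bwWeight α * ∑ i, ‖(f i).coeff α‖ ^ 2) := by
  simp only [bwNorm, fun i => re_bwInner_self (hS i), Finset.mul_sum]
  rw [Finset.sum_comm]

variable [DecidableEq ι]

theorem sum_norm_sq_mulVec_of_mem_unitaryGroup {U : Matrix ι ι ℂ}
    (hU : U ∈ Matrix.unitaryGroup ι ℂ) (c : ι → ℂ) :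
    ∑ i, ‖(U *ᵥ c) i‖ ^ 2 = ∑ i, ‖c i‖ ^ 2 := by
  have star_dotProduct_self (v : ι → ℂ) : star v ⬝ᵥ v = ((∑ i, ‖v i‖ ^ 2 : ℝ) : ℂ) := by
    simp only [dotProduct, Pi.star_apply, RCLike.star_def, Complex.conj_mul', Complex.ofReal_sum,
      Complex.ofReal_pow]
  apply Complex.ofReal_injective
  rw [← star_dotProduct_self, ← star_dotProduct_self, Matrix.star_mulVec, Matrix.dotProduct_mulVec,
    Matrix.vecMul_vecMul, ← Matrix.star_eq_conjTranspose, Matrix.mem_unitaryGroup_iff'.mp hU,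
    Matrix.vecMul_one]

theorem bwNorm_shuffle_of_mem_unitaryGroup {U : Matrix ι ι ℂ} (hU : U ∈ Matrix.unitaryGroup ι ℂ)
    (f : ι → MvPolynomial σ ℂ) : bwNorm (shuffle U f) = bwNorm f := by
  obtain ⟨S, hS⟩ := exists_finset_support_subset f
  simp only [bwNorm_eq_sqrt_sum hS, bwNorm_eq_sqrt_sum (support_shuffle_subset U hS), coeff_shuffle,
    sum_norm_sq_mulVec_of_mem_unitaryGroup hU]

theorem norm_coeff_shuffle_expDiag_scaleSystem (x : ι → ℝ) (y : σ → ℝ)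
    (f : ι → MvPolynomial σ ℂ) (i : ι) (α : σ →₀ ℕ) :
    ‖(shuffle (expDiag fun k => (x k : ℂ))
        (scaleSystem (fun j => Real.exp (y j)) f) i).coeff α‖ =
      Real.exp (x i) * ‖(f i).coeff α‖ *
        ∏ j ∈ α.support, Real.exp (y j) ^ (-(α j : ℤ)) := by
  rw [coeff_shuffle, expDiag, Matrix.mulVec_diagonal, scaleSystem, coeff_scalePoly, ← mul_assoc,
    Finsupp.prod, norm_mul, norm_mul, Complex.norm_exp, Complex.ofReal_re, Complex.norm_real,
    Real.norm_of_nonneg (Finset.prod_nonneg fun j _ =>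
      pow_nonneg (inv_nonneg.mpr (Real.exp_pos _).le) _)]
  simp only [inv_pow, zpow_neg, zpow_natCast]

theorem logConvex_bwNorm_shuffle_expDiag_scaleSystem (f : ι → MvPolynomial σ ℂ) :
    LogConvex fun x : (ι → ℝ) × (σ → ℝ) => bwNorm (shuffle (expDiag fun k => (x.1 k : ℂ))
      (scaleSystem (fun j => Real.exp (x.2 j)) f)) := by
  obtain ⟨S, hS⟩ := exists_finset_support_subset f
  have hS' (x : (ι → ℝ) × (σ → ℝ)) := support_shuffle_subset (expDiag fun k => (x.1 k : ℂ))
    (f := scaleSystem (fun j => Real.exp (x.2 j)) f)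
    (fun i => (support_scalePoly_subset (fun j => Real.exp (x.2 j)) (f i)).trans (hS i))
  simp only [fun x => bwNorm_eq_sqrt_sum (hS' x), norm_coeff_shuffle_expDiag_scaleSystem]
  let row (i : ι) : (ι → ℝ) × (σ → ℝ) →ₗ[ℝ] ℝ := LinearMap.proj i ∘ₗ LinearMap.fst ℝ _ _
  let col (j : σ) : (ι → ℝ) × (σ → ℝ) →ₗ[ℝ] ℝ := LinearMap.proj j ∘ₗ LinearMap.snd ℝ _ _
  have logConvex_norm_coeff (i : ι) (α : σ →₀ ℕ) : LogConvex fun x : (ι → ℝ) × (σ → ℝ) =>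
      Real.exp (x.1 i) * ‖(f i).coeff α‖ *
        ∏ j ∈ α.support, Real.exp (x.2 j) ^ (-(α j : ℤ)) :=
    ((logConvex_exp ((row i).convexOn convex_univ)).mul (logConvex_const (norm_nonneg _))).mul
      (LogConvex.prod fun j _ => logConvex_exp_zpow (col j) _)
  exact (LogConvex.sum fun α _ => (logConvex_const (bwWeight_nonneg α)).mul
    (LogConvex.sum fun i _ => (logConvex_norm_coeff i α).pow 2)).sqrt

end PolynomialSystem

section LocalCond

open Matrix

theorem isMoorePenrose_pinv {m n : Type*} [Fintype m] [Fintype n] (A : Matrix m n ℂ) :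
    IsMoorePenrose A (pinv A) :=
  Classical.choose_spec (exists_isMoorePenrose A)

theorem pinv_eq_of_mul_eq_one {m : Type*} [Fintype m] [DecidableEq m] {A B : Matrix m m ℂ}
    (hAB : A * B = 1) : pinv A = B := by
  have hBA : B * A = 1 := mul_eq_one_comm.mp hAB
  refine (isMoorePenrose_pinv A).unique ⟨?_, ?_, ?_, ?_⟩
  · rw [hAB, Matrix.one_mul]
  · rw [hBA, Matrix.one_mul]
  · exact hAB ▸ isHermitian_one
  · exact hBA ▸ isHermitian_one

theorem IsMoorePenrose.unitary_mul {m n : Type*} [Fintype m] [Fintype n] [DecidableEq m]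
    {A : Matrix m n ℂ} {B : Matrix n m ℂ} (hAB : IsMoorePenrose A B) {U : Matrix m m ℂ}
    (hU : U ∈ unitaryGroup m ℂ) : IsMoorePenrose (U * A) (B * Uᴴ) := by
  have mul_mul_cancel : B * Uᴴ * (U * A) = B * A := by
    rw [Matrix.mul_assoc, ← Matrix.mul_assoc Uᴴ, ← star_eq_conjTranspose,
      mem_unitaryGroup_iff'.mp hU, Matrix.one_mul]
  refine ⟨?_, ?_, ?_, ?_⟩
  · rw [Matrix.mul_assoc, mul_mul_cancel, Matrix.mul_assoc U, ← Matrix.mul_assoc A,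
      hAB.mul_mul_left]
  · rw [mul_mul_cancel, ← Matrix.mul_assoc, hAB.mul_mul_right]
  · simpa only [Matrix.mul_assoc] using
      isHermitian_mul_mul_conjTranspose U hAB.isHermitian_left
  · rw [mul_mul_cancel]
    exact hAB.isHermitian_right

theorem pinv_unitary_mul {m n : Type*} [Fintype m] [Fintype n] [DecidableEq m]
    {U : Matrix m m ℂ} (hU : U ∈ unitaryGroup m ℂ) (A : Matrix m n ℂ) :
    pinv (U * A) = pinv A * Uᴴ :=
  (isMoorePenrose_pinv _).unique ((isMoorePenrose_pinv A).unitary_mul hU)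

theorem localCond_shuffle_of_mem_unitaryGroup {σ ι : Type*} [Fintype σ] [Fintype ι]
    [DecidableEq σ] [DecidableEq ι] {N : Seminorm ℂ (Matrix σ ι ℂ)}
    (hN : IsUnitarilyInvariantNorm N) {U : Matrix ι ι ℂ} (hU : U ∈ unitaryGroup ι ℂ)
    (f : ι → MvPolynomial σ ℂ) (ζ : σ → ℂ) :
    localCond N (shuffle U f) ζ = localCond N f ζ := by
  rw [localCond, bwNorm_shuffle_of_mem_unitaryGroup hU, jacobian_shuffle, pinv_unitary_mul hU,
    ← star_eq_conjTranspose, hN.mul_unitary _ (Unitary.star_mem hU), localCond]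

variable {ι : Type*} [Fintype ι] [DecidableEq ι]

theorem pinv_jacobian_shuffle_expDiag_scaleSystem {f : ι → MvPolynomial ι ℂ} {ξ : ι → ℂ}
    (hJ : (jacobian f ξ).det ≠ 0) (x y : ι → ℝ) :
    pinv (jacobian (shuffle (expDiag fun i => (x i : ℂ)) (scaleSystem (fun j => Real.exp (y j)) f))
        (scalePoint (fun j => Real.exp (y j)) ξ)) =
      expDiag (fun j => (y j : ℂ)) * (jacobian f ξ)⁻¹ * expDiag fun i => ((-x i : ℝ) : ℂ) := by
  have diagonal_inv_exp : (diagonal fun j => (((Real.exp (y j))⁻¹ : ℝ) : ℂ)) =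
      expDiag (-fun j => (y j : ℂ)) := by
    simp only [expDiag, Pi.neg_apply, ← Complex.ofReal_neg, ← Complex.ofReal_exp, Real.exp_neg]
  have neg_expDiag_mul : expDiag (-fun j => (y j : ℂ)) * expDiag (fun j => (y j : ℂ)) = 1 := by
    simpa only [neg_neg] using expDiag_mul_neg (-fun j => (y j : ℂ))
  have ofReal_neg_eq : (fun i => ((-x i : ℝ) : ℂ)) = -fun i => (x i : ℂ) :=
    funext fun i => Complex.ofReal_neg (x i)
  rw [jacobian_shuffle, jacobian_scaleSystem fun j => (Real.exp_pos (y j)).ne', diagonal_inv_exp,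
    ofReal_neg_eq]
  apply pinv_eq_of_mul_eq_one
  simp only [Matrix.mul_assoc]
  rw [← Matrix.mul_assoc (expDiag (-_)), neg_expDiag_mul, Matrix.one_mul,
    ← Matrix.mul_assoc (jacobian f ξ), mul_nonsing_inv _ hJ.isUnit, Matrix.one_mul,
    expDiag_mul_neg]

theorem logConvex_localCond_shuffle_expDiag_scaleSystem {f : ι → MvPolynomial ι ℂ} {ξ : ι → ℂ}
    (hJ : (jacobian f ξ).det ≠ 0) {N : Seminorm ℂ (Matrix ι ι ℂ)}
    (hN : IsUnitarilyInvariantNorm N) :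
    LogConvex fun x : (ι → ℝ) × (ι → ℝ) => localCond N
      (shuffle (expDiag fun i => (x.1 i : ℂ)) (scaleSystem (fun j => Real.exp (x.2 j)) f))
      (scalePoint (fun j => Real.exp (x.2 j)) ξ) := by
  simp only [localCond, pinv_jacobian_shuffle_expDiag_scaleSystem hJ]
  exact (logConvex_bwNorm_shuffle_expDiag_scaleSystem f).mul
    ((hN.logConvex_expDiag_mul_mul_expDiag (jacobian f ξ)⁻¹).comp_linearMap
      ((LinearMap.snd ℝ (ι → ℝ) (ι → ℝ)).prod (-LinearMap.fst ℝ (ι → ℝ) (ι → ℝ))))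

end LocalCond

section Geodesic

open Matrix

theorem exists_unitary_exp_smul_eq {m : Type*} [Fintype m] [DecidableEq m] {H : Matrix m m ℂ}
    (hH : H.IsHermitian) : ∃ U ∈ unitaryGroup m ℂ, ∃ l : m → ℝ, ∀ s : ℝ,
      NormedSpace.exp (s • H) = U * expDiag (fun k => ((s * l k : ℝ) : ℂ)) * star U := by
  let U : Matrix m m ℂ := hH.eigenvectorUnitary.1
  have U_mem : U ∈ unitaryGroup m ℂ := hH.eigenvectorUnitary.2
  refine ⟨U, U_mem, hH.eigenvalues, fun s => ?_⟩
  have U_mul_star : U * star U = 1 := mem_unitaryGroup_iff.mp U_mem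
  have inv_U : U⁻¹ = star U := inv_eq_right_inv U_mul_star
  have smul_H : s • H = U * diagonal (fun k => ((s * hH.eigenvalues k : ℝ) : ℂ)) * U⁻¹ := by
    conv_lhs => rw [hH.spectral_theorem]
    rw [Unitary.conjStarAlgAut_apply, inv_U, ← Matrix.smul_mul, ← Matrix.mul_smul,
      ← diagonal_smul]
    congr 3
    ext k
    simp
  rw [smul_H, exp_conj _ _ (IsUnit.of_mul_eq_one _ U_mul_star), exp_diagonal_eq_expDiag, inv_U]

variable {n : ℕ}

theorem cosetRep_eq_of_unitary_mul {g g' : PreGroup n} {U : Matrix (Fin n) (Fin n) ℂ}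
    (hU : U ∈ unitaryGroup (Fin n) ℂ) (hfst : (g'.1 : Matrix (Fin n) (Fin n) ℂ) = U * g.1)
    (hsnd : ∀ i, ‖(g'.2 i : ℂ)‖ = ‖(g.2 i : ℂ)‖) : cosetRep g' = cosetRep g := by
  refine Prod.ext (Subtype.ext ?_) (Subtype.ext (funext hsnd))
  simp only [cosetRep]
  rw [hfst, conjTranspose_mul, Matrix.mul_assoc, ← Matrix.mul_assoc Uᴴ, ← star_eq_conjTranspose U,
    mem_unitaryGroup_iff'.mp hU, Matrix.one_mul]

theorem exists_unitary_mul_eq_cosetRep_fst (g : PreGroup n) :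
    ∃ U ∈ unitaryGroup (Fin n) ℂ, (cosetRep g).1.1 = U * (g.1 : Matrix (Fin n) (Fin n) ℂ) := by
  let g' : PreGroup n := ((cosetRep g).1.2.isUnit.unit, fun i =>
    Units.mk0 ((cosetRep g).2.1 i : ℂ) (Complex.ofReal_ne_zero.mpr ((cosetRep g).2.2 i).ne'))
  have same_coset : cosetRep g = cosetRep g' :=
    (cosetRep_self (cosetRep g) g' rfl fun _ => rfl).symm
  obtain ⟨k, hk, hg'⟩ := (cosetRep_eq_iff g g').mp same_coset
  exact ⟨k.1, hk.1, congrArg (fun q : PreGroup n => (q.1 : Matrix (Fin n) (Fin n) ℂ)) hg'⟩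

/-- The point with coordinates `x` on the maximal flat through the coset of `(A, 1)`, on which the
diagonal matrices in `Herm(n) × ℝ^n` act by translations. -/
def flatPoint (A : GL (Fin n) ℂ) (x : (Fin n → ℝ) × (Fin n → ℝ)) : PreGroup n :=
  expPair (diagonal fun k => (x.1 k : ℂ)) x.2 * (A, 1)

theorem flatPoint_fst (A : GL (Fin n) ℂ) (x : (Fin n → ℝ) × (Fin n → ℝ)) :
    ((flatPoint A x).1 : Matrix (Fin n) (Fin n) ℂ) = expDiag (fun k => (x.1 k : ℂ)) * A := by
  rw [← exp_diagonal_eq_expDiag]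
  rfl

theorem cosetRep_flatPoint_snd (A : GL (Fin n) ℂ) (x : (Fin n → ℝ) × (Fin n → ℝ)) :
    (cosetRep (flatPoint A x)).2.1 = fun j => Real.exp (x.2 j) := by
  funext j
  simp [cosetRep, flatPoint, expPair]

theorem exists_geodesic_eq_flatPoint_lineMap (g : PreGroup n) {H : Matrix (Fin n) (Fin n) ℂ}
    (hH : H.IsHermitian) (v : Fin n → ℝ) :
    ∃ (A : GL (Fin n) ℂ) (x y : (Fin n → ℝ) × (Fin n → ℝ)), ∀ s : ℝ,
      cosetRep (expPair (s • H) (s • v) * g) =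
        cosetRep (flatPoint A (AffineMap.lineMap x y s)) := by
  obtain ⟨U, hU, l, exp_smul_H⟩ := exists_unitary_exp_smul_eq hH
  let τ : Fin n → ℝ := fun j => Real.log ‖(g.2 j : ℂ)‖
  let U_inv : GL (Fin n) ℂ := (Unitary.toUnits ⟨U, hU⟩)⁻¹
  have coe_U_inv : (U_inv : Matrix (Fin n) (Fin n) ℂ) = star U := rfl
  refine ⟨U_inv * g.1, (0, τ), (l, v + τ), fun s => cosetRep_eq_of_unitary_mul hU ?_ fun j => ?_⟩
  · have lineMap_fst : (AffineMap.lineMap (0, τ) (l, v + τ) s : (Fin n → ℝ) × (Fin n → ℝ)).1 =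
        s • l := by
      simp [AffineMap.lineMap_apply_module']
    rw [flatPoint_fst, lineMap_fst, Units.val_mul, coe_U_inv]
    calc NormedSpace.exp (s • H) * (g.1 : Matrix (Fin n) (Fin n) ℂ)
        = U * expDiag (fun k => ((s * l k : ℝ) : ℂ)) * star U * g.1 := by rw [exp_smul_H]
      _ = _ := by simp only [Matrix.mul_assoc, Pi.smul_apply, smul_eq_mul]
  · have norm_eq_exp : ‖(g.2 j : ℂ)‖ = Real.exp (τ j) :=
      (Real.exp_log (norm_pos_iff.mpr (g.2 j).ne_zero)).symm
    simp [flatPoint, expPair, AffineMap.lineMap_apply_module', Real.exp_add, norm_eq_exp,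
      Complex.norm_exp]

theorem geodesicallyConvex_of_convexOn_flat {F : PD n × PosVec n → ℝ}
    (hF : ∀ A : GL (Fin n) ℂ, ConvexOn ℝ Set.univ fun x => F (cosetRep (flatPoint A x))) :
    GeodesicallyConvex F := by
  intro g H v hH
  obtain ⟨A, x, y, geodesic_eq⟩ := exists_geodesic_eq_flatPoint_lineMap g hH v
  simp only [geodesic_eq]
  exact (hF A).comp_affineMap (AffineMap.lineMap x y)

namespace GeodesicallyConvex

variable {F G : PD n × PosVec n → ℝ}

theorem add (hF : GeodesicallyConvex F) (hG : GeodesicallyConvex G) :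
    GeodesicallyConvex fun q => F q + G q :=
  fun g H v hH => (hF g H v hH).add (hG g H v hH)

theorem comp_inv_snd (hF : GeodesicallyConvex F) : GeodesicallyConvex fun q =>
    F (q.1, ⟨q.2.1⁻¹, fun i => inv_pos.mpr (q.2.2 i)⟩) := by
  intro g H v hH
  convert hF (g.1, g.2⁻¹) H (-v) hH using 3 with s
  refine Prod.ext rfl (Subtype.ext (funext fun i => ?_))
  simp [cosetRep, expPair, Complex.norm_exp, Real.exp_neg, mul_comm]

end GeodesicallyConvex

theorem localCond_cosetRep_flatPoint {N : Seminorm ℂ (Matrix (Fin n) (Fin n) ℂ)}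
    (hN : IsUnitarilyInvariantNorm N) (p : Fin n → MvPolynomial (Fin n) ℂ) (ξ : Fin n → ℂ)
    (A : GL (Fin n) ℂ) (x : (Fin n → ℝ) × (Fin n → ℝ)) :
    localCond N (shuffle (cosetRep (flatPoint A x)).1.1
        (scaleSystem (cosetRep (flatPoint A x)).2.1 p))
        (scalePoint (cosetRep (flatPoint A x)).2.1 ξ) =
      localCond N (shuffle (expDiag fun i => (x.1 i : ℂ))
        (scaleSystem (fun j => Real.exp (x.2 j)) (shuffle A p)))
        (scalePoint (fun j => Real.exp (x.2 j)) ξ) := by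
  obtain ⟨U, hU, cosetRep_fst⟩ := exists_unitary_mul_eq_cosetRep_fst (flatPoint A x)
  rw [cosetRep_fst, shuffle_mul, localCond_shuffle_of_mem_unitaryGroup hN hU, flatPoint_fst,
    cosetRep_flatPoint_snd, shuffle_mul, scaleSystem_shuffle]

theorem geodesicallyConvex_localCond {p : Fin n → MvPolynomial (Fin n) ℂ} {ξ : Fin n → ℂ}
    (hJ : (jacobian p ξ).det ≠ 0) {N : Seminorm ℂ (Matrix (Fin n) (Fin n) ℂ)}
    (hN : IsUnitarilyInvariantNorm N) :
    GeodesicallyConvex fun q => localCond N (shuffle q.1.1 (scaleSystem q.2.1 p))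
      (scalePoint q.2.1 ξ) := by
  refine geodesicallyConvex_of_convexOn_flat fun A => ?_
  have hJA : (jacobian (shuffle A p) ξ).det ≠ 0 := by
    rw [jacobian_shuffle, det_mul]
    exact mul_ne_zero A.det.ne_zero hJ
  simp only [localCond_cosetRep_flatPoint hN]
  exact (logConvex_localCond_shuffle_expDiag_scaleSystem hJA hN).convexOn

end Geodesic

section HFun

section ArithmeticGeometricMean

variable {ι : Type*} [Fintype ι] {r : ι → ℝ}

theorem card_mul_prod_le_sum_pow_card (hr : ∀ i, 0 ≤ r i) :
    Fintype.card ι * ∏ i, r i ≤ ∑ i, r i ^ Fintype.card ι := by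
  cases isEmpty_or_nonempty ι
  · simp
  have prod_rpow : ∏ i, (r i ^ Fintype.card ι) ^ (Fintype.card ι : ℝ)⁻¹ = ∏ i, r i :=
    Finset.prod_congr rfl fun i _ => Real.pow_rpow_inv_natCast (hr i) Fintype.card_ne_zero
  have card_pos : (0 : ℝ) < Fintype.card ι := Nat.cast_pos.mpr Fintype.card_pos
  have amgm := Real.geom_mean_le_arith_mean_weighted Finset.univ
    (fun _ : ι => (Fintype.card ι : ℝ)⁻¹) (fun i => r i ^ Fintype.card ι)
    (fun _ _ => (inv_pos.mpr card_pos).le) (by simp) (fun i _ => pow_nonneg (hr i) _)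
  rwa [prod_rpow, ← Finset.mul_sum, le_inv_mul_iff₀ card_pos] at amgm

theorem card_mul_prod_eq_sum_pow_card_iff (hr : ∀ i, 0 ≤ r i) :
    Fintype.card ι * ∏ i, r i = ∑ i, r i ^ Fintype.card ι ↔ ∀ i j, r i = r j := by
  cases isEmpty_or_nonempty ι
  · simp
  have prod_rpow : ∏ i, (r i ^ Fintype.card ι) ^ (Fintype.card ι : ℝ)⁻¹ = ∏ i, r i :=
    Finset.prod_congr rfl fun i _ => Real.pow_rpow_inv_natCast (hr i) Fintype.card_ne_zero
  have card_pos : (0 : ℝ) < Fintype.card ι := Nat.cast_pos.mpr Fintype.card_pos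
  have amgm_eq := Real.geom_mean_eq_arith_mean_weighted_iff_of_pos Finset.univ
    (fun _ : ι => (Fintype.card ι : ℝ)⁻¹) (fun i => r i ^ Fintype.card ι)
    (fun _ _ => inv_pos.mpr card_pos) (by simp) (fun i _ => pow_nonneg (hr i) _)
  rw [prod_rpow, ← Finset.mul_sum, eq_inv_mul_iff_mul_eq₀ card_pos.ne'] at amgm_eq
  simpa only [Finset.mem_univ, forall_const, pow_left_inj₀ (hr _) (hr _) Fintype.card_ne_zero]
    using amgm_eq

end ArithmeticGeometricMean

variable {n : ℕ} {ξ : Fin n → ℂ}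

theorem convexOn_hFun_exp (hξ : ∀ i, ξ i ≠ 0) :
    ConvexOn ℝ Set.univ fun x : Fin n → ℝ => hFun ξ fun j => Real.exp (x j) := by
  simp only [hFun]
  cases isEmpty_or_nonempty (Fin n)
  · simpa using convexOn_const (0 : ℝ) convex_univ
  have coeff_pos (i : Fin n) : 0 < ∏ j, ‖ξ j‖ ^ omega n i j :=
    Finset.prod_pos fun j _ => zpow_pos (norm_pos_iff.mpr (hξ j)) _
  let coord (j : Fin n) : (Fin n → ℝ) →ₗ[ℝ] ℝ := LinearMap.proj j
  refine (LogConvex.sum fun i _ => (logConvex_const (coeff_pos i).le).mul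
    (LogConvex.prod fun j _ => logConvex_exp_zpow (coord j) _)).convexOn_log fun x => ?_
  exact Finset.sum_pos (fun i _ => mul_pos (coeff_pos i)
    (Finset.prod_pos fun j _ => zpow_pos (Real.exp_pos _) _)) Finset.univ_nonempty

theorem geodesicallyConvex_hFun (hξ : ∀ i, ξ i ≠ 0) :
    GeodesicallyConvex fun q : PD n × PosVec n => hFun ξ q.2.1 := by
  refine geodesicallyConvex_of_convexOn_flat fun A => ?_
  simp only [cosetRep_flatPoint_snd]
  exact (convexOn_hFun_exp hξ).comp_linearMap (LinearMap.snd ℝ (Fin n → ℝ) (Fin n → ℝ))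

theorem hFun_eq_log_sum_pow_div_prod (hξ : ∀ i, ξ i ≠ 0) (t : PosVec n) :
    hFun ξ t.1 = Real.log ((∑ i, (‖ξ i‖ * (t.1 i)⁻¹) ^ n) / ∏ j, ‖ξ j‖ * (t.1 j)⁻¹) := by
  have ratio_ne_zero (j : Fin n) : ‖ξ j‖ * (t.1 j)⁻¹ ≠ 0 :=
    mul_ne_zero (norm_ne_zero_iff.mpr (hξ j)) (inv_ne_zero (t.2 j).ne')
  rw [hFun, Finset.sum_div]
  congr 1
  refine Finset.sum_congr rfl fun i _ => ?_
  rw [← Finset.prod_mul_distrib]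
  calc ∏ j, ‖ξ j‖ ^ omega n i j * t.1 j ^ (-omega n i j)
      = ∏ j, (‖ξ j‖ * (t.1 j)⁻¹) ^ ((n : ℤ) * (Pi.single i 1 : Fin n → ℤ) j) /
          (‖ξ j‖ * (t.1 j)⁻¹) :=
        Finset.prod_congr rfl fun j _ => by
          rw [zpow_neg, ← inv_zpow, ← mul_zpow, omega, zpow_sub_one₀ (ratio_ne_zero j),
            div_eq_mul_inv]
    _ = (‖ξ i‖ * (t.1 i)⁻¹) ^ n / ∏ j, ‖ξ j‖ * (t.1 j)⁻¹ := by
        rw [Finset.prod_div_distrib, Fintype.prod_eq_single i fun j hj => by simp [hj]]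
        simp

theorem prod_norm_mul_inv_pos (hξ : ∀ i, ξ i ≠ 0) (t : PosVec n) :
    0 < ∏ i, ‖ξ i‖ * (t.1 i)⁻¹ :=
  Finset.prod_pos fun i _ => mul_pos (norm_pos_iff.mpr (hξ i)) (inv_pos.mpr (t.2 i))

theorem natCast_le_sum_pow_div_prod (hξ : ∀ i, ξ i ≠ 0) (t : PosVec n) :
    n ≤ (∑ i, (‖ξ i‖ * (t.1 i)⁻¹) ^ n) / ∏ j, ‖ξ j‖ * (t.1 j)⁻¹ := by
  rw [le_div_iff₀ (prod_norm_mul_inv_pos hξ t)]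
  simpa only [Fintype.card_fin] using card_mul_prod_le_sum_pow_card
    (r := fun i => ‖ξ i‖ * (t.1 i)⁻¹) fun i =>
      mul_nonneg (norm_nonneg _) (inv_nonneg.mpr (t.2 i).le)

theorem log_natCast_le_hFun (hξ : ∀ i, ξ i ≠ 0) (t : PosVec n) : Real.log n ≤ hFun ξ t.1 := by
  rcases n.eq_zero_or_pos with rfl | hn
  · simp [hFun]
  rw [hFun_eq_log_sum_pow_div_prod hξ]
  exact Real.log_le_log (Nat.cast_pos.mpr hn) (natCast_le_sum_pow_div_prod hξ t)

theorem hFun_eq_log_natCast_iff (hξ : ∀ i, ξ i ≠ 0) (t : PosVec n) :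
    hFun ξ t.1 = Real.log n ↔ ∀ i j, ‖ξ i‖ * (t.1 i)⁻¹ = ‖ξ j‖ * (t.1 j)⁻¹ := by
  rcases n.eq_zero_or_pos with rfl | hn
  · simp [hFun]
  have n_pos : (0 : ℝ) < n := Nat.cast_pos.mpr hn
  have amgm_eq_iff := card_mul_prod_eq_sum_pow_card_iff (r := fun i => ‖ξ i‖ * (t.1 i)⁻¹)
    fun i => mul_nonneg (norm_nonneg _) (inv_nonneg.mpr (t.2 i).le)
  rw [hFun_eq_log_sum_pow_div_prod hξ, Real.log_injOn_pos.eq_iff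
    (n_pos.trans_le (natCast_le_sum_pow_div_prod hξ t)) n_pos,
    div_eq_iff (prod_norm_mul_inv_pos hξ t).ne', eq_comm, ← amgm_eq_iff, Fintype.card_fin]

theorem hFun_minimal_iff (hξ : ∀ i, ξ i ≠ 0) (t : PosVec n) :
    (∀ t' : PosVec n, hFun ξ t.1 ≤ hFun ξ t'.1) ↔
      ∀ i j, ‖ξ i‖ * (t.1 i)⁻¹ = ‖ξ j‖ * (t.1 j)⁻¹ := by
  let normVec : PosVec n := ⟨fun i => ‖ξ i‖, fun i => norm_pos_iff.mpr (hξ i)⟩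
  have hFun_normVec : hFun ξ normVec.1 = Real.log n := by
    refine (hFun_eq_log_natCast_iff hξ normVec).mpr fun i j => ?_
    simp only [normVec, mul_inv_cancel₀ (norm_ne_zero_iff.mpr (hξ _))]
  rw [← hFun_eq_log_natCast_iff hξ]
  exact ⟨fun hmin => ((hmin normVec).trans_eq hFun_normVec).antisymm (log_natCast_le_hFun hξ t),
    fun heq t' => heq.trans_le (log_natCast_le_hFun hξ t')⟩

end HFun

end Precond

end

theorem mainTheorem9 (n : ℕ) (p : Fin n → MvPolynomial (Fin n) ℂ) (ξ : Fin n → ℂ)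
    (hξ : ∀ i, ξ i ≠ 0) (hJ : (Precond.jacobian p ξ).det ≠ 0)
    (N : Seminorm ℂ (Matrix (Fin n) (Fin n) ℂ)) (hN : Precond.IsUnitarilyInvariantNorm N) :
    Precond.GeodesicallyConvex (fun q : Precond.PD n × Precond.PosVec n =>
      Precond.localCond N
        (Precond.shuffle q.1.1 (Precond.scaleSystem q.2.1⁻¹ p)) (Precond.scalePoint q.2.1⁻¹ ξ)
      + Precond.hFun ξ q.2.1) ∧
    Precond.GeodesicallyConvex (fun q : Precond.PD n × Precond.PosVec n =>
      Precond.localCond N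
        (Precond.shuffle q.1.1 (Precond.scaleSystem q.2.1 p)) (Precond.scalePoint q.2.1 ξ)
      + Precond.hFun ξ q.2.1) ∧
    Precond.GeodesicallyConvex (fun q : Precond.PD n × Precond.PosVec n =>
      Precond.hFun ξ q.2.1) ∧
    ∀ t : Precond.PosVec n,
      (∀ t' : Precond.PosVec n, Precond.hFun ξ t.1 ≤ Precond.hFun ξ t'.1) ↔
        ∀ i j, ‖ξ i‖ * (t.1 i)⁻¹ = ‖ξ j‖ * (t.1 j)⁻¹ := by
  have hμ := Precond.geodesicallyConvex_localCond hJ hN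
  have hh := Precond.geodesicallyConvex_hFun hξ
  exact ⟨hμ.comp_inv_snd.add hh, hμ.add hh, hh, Precond.hFun_minimal_iff hξ⟩
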